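/- Fix an integer $m \ge 1$. A deck with $n$ card types is a vector $d=(d_1,\dots,d_n)$ of non-negative integers, where $d_i$ is the number of remaining copies of type $i$; let $\mathrm{supp}(d)=\{i : d_i>0\}$. A Guesser strategy $\mathcal G$ assigns to every nonzero deck $d$ (for every $n$) a random element $\mathcal G(d)$ of $\{1,\dots,n\}$; a Shuffler strategy $\mathcal S$ assigns to every nonzero deck $d$ (for every $n$) a random element $\mathcal S(d)$ of $\mathrm{supp}(d)$. In the Guesser-Shuffler game, as long as the current deck $d$ is nonzero, Shuffler draws a card type $i=\mathcal S(d)$ and Guesser simultaneously and independently guesses $\mathcal G(d)$; Guesser scores a point if $\mathcal G(d)=i$, and in either case one copy of $i$ is removed from the deck. Let $C_{m,n}(\mathcal G,\mathcal S)$ be the total number of points when the game starts with $m$ copies of each of $n$ card types. The greedy Shuffler strategy $\mathcal S^*$ draws a uniformly random element of $\mathrm{supp}(d)$ at every nonzero deck $d$. Then, for every $n$, all the minima and maxima below exist (the inner ones for every Shuffler strategy $\mathcal S$) and the equalities below hold, and, for $m$ fixed and $n\to\infty$, the asymptotics below hold: $$\min_{\mathcal S}\max_{\mathcal G}\mathbb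 E[C_{m,n}(\mathcal G,\mathcal S)]=\max_{\mathcal G}\mathbb E[C_{m,n}(\mathcal G,\mathcal S^*)]\sim \log n,$$ $$\max_{\mathcal S}\min_{\mathcal G}\mathbb E[C_{m,n}(\mathcal G,\mathcal S)]=\min_{\mathcal G}\mathbb E[C_{m,n}(\mathcal G,\mathcal S^*)]\sim \Gamma\left(1+\tfrac1m\right)(m!)^{1/m}\, n^{-1/m}.$$ Here $\log$ is the natural logarithm, $\Gamma$ is the gamma function, and $a_n\sim b_n$ means $a_n/b_n\to1$. -/

import Mathlib

open Filter Asymptotics MeasureTheory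

noncomputable section

namespace GuesserShuffler

/-- A deck with card types `Fin n`: `d i` is the number of copies of type `i` left in the deck. -/
abbrev Deck (n : ℕ) : Type := Fin n → ℕ

/-- The set of card types that are still in the deck. -/
def Deck.supp {n : ℕ} (d : Deck n) : Finset (Fin n) := {i | 0 < d i}

theorem Deck.supp_nonempty {n : ℕ} {d : Deck n} (hd : d ≠ 0) : d.supp.Nonempty := by
  obtain ⟨i, hi⟩ := Function.ne_iff.mp hd
  exact ⟨i, by simpa [Deck.supp] using Nat.pos_of_ne_zero hi⟩

/-- The deck after one copy of card type `i` has been removed. -/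
def Deck.remove {n : ℕ} (d : Deck n) (i : Fin n) : Deck n := d - Pi.single i 1

theorem Deck.sum_remove_lt {n : ℕ} {d : Deck n} {i : Fin n} (hi : i ∈ d.supp) :
    ∑ j, d.remove i j < ∑ j, d j := by
  have hi' : 0 < d i := by simpa [Deck.supp] using hi
  refine Finset.sum_lt_sum (fun j _ => ?_) ⟨i, Finset.mem_univ i, ?_⟩
  · simp [Deck.remove]
  · simp [Deck.remove, hi']

/-- A Guesser strategy: to every nonzero deck, on any number of card types, it assigns the law of
the guess, an arbitrary probability distribution on all card types. -/
def GuesserStrategy : Type := ∀ (n : ℕ) (d : Deck n), d ≠ 0 → PMF (Fin n)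

/-- A Shuffler strategy: to every nonzero deck, on any number of card types, it assigns the law of
the next card, a probability distribution supported on the card types still in the deck. -/
structure ShufflerStrategy where
  /-- the law of the next card drawn from a nonzero deck -/
  law : ∀ (n : ℕ) (d : Deck n), d ≠ 0 → PMF (Fin n)
  /-- only cards that are still in the deck are drawn -/
  mem_supp : ∀ (n : ℕ) (d : Deck n) (hd : d ≠ 0), ∀ i ∈ (law n d hd).support, i ∈ d.supp

/-- The greedy strategy for Shuffler: the next card type is uniform among the card types that are
still in the deck, whatever their multiplicities. -/
def greedy : ShufflerStrategy where
  law := fun _ d hd => PMF.uniformOfFinset d.supp (Deck.supp_nonempty hd)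
  mem_supp := fun _ _ _ _ hi => (PMF.mem_support_uniformOfFinset_iff _ _).mp hi

/-- The law of Guesser's score when the game starts from the deck `d`. If the deck is empty the
score is `0`. Otherwise Shuffler draws `i` and Guesser independently guesses `g`; one point is
scored if `g = i`, and the game goes on with one copy of `i` removed. -/
def score (G : GuesserStrategy) (S : ShufflerStrategy) {n : ℕ} (d : Deck n) : PMF ℕ :=
  if hd : d = 0 then PMF.pure 0
  else
    (S.law n d hd).bindOnSupport fun i hi =>
      (G n d hd).bind fun g =>
        (score G S (d.remove i)).map fun c => (if g = i then 1 else 0) + c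
termination_by ∑ j, d j
decreasing_by exact Deck.sum_remove_lt (S.mem_supp n d hd i hi)

/-- The expected number `E[C_{m,n}(G, S)]` of correct guesses when the game starts with `m` copies
of each of `n` card types. -/
def expScore (m n : ℕ) (G : GuesserStrategy) (S : ShufflerStrategy) : ℝ :=
  ∫ c, (c : ℝ) ∂(score G S (fun _ : Fin n => m)).toMeasure

/-- `max_G E[C_{m,n}(G, S)]`, as a supremum. -/
def maxScore (m n : ℕ) (S : ShufflerStrategy) : ℝ := ⨆ G : GuesserStrategy, expScore m n G S

/-- `min_G E[C_{m,n}(G, S)]`, as an infimum. -/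
def minScore (m n : ℕ) (S : ShufflerStrategy) : ℝ := ⨅ G : GuesserStrategy, expScore m n G S

/-- `min_S max_G E[C_{m,n}(G, S)]`, with the minimum over `S` as an infimum. -/
def minMaxScore (m n : ℕ) : ℝ := ⨅ S : ShufflerStrategy, maxScore m n S

/-- `max_S min_G E[C_{m,n}(G, S)]`, with the maximum over `S` as a supremum. -/
def maxMinScore (m n : ℕ) : ℝ := ⨆ S : ShufflerStrategy, minScore m n S

end GuesserShuffler

end

noncomputable section

namespace GuesserShuffler

/-! Guesses never influence the deck, so against a fixed Shuffler the optimal Guesser is myopic: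
always guess a most (or least) likely card. This yields one-step recursions (`val_bestReply`,
`val_worstReply`).

Against the greedy Shuffler, let `f` be the best value. Its recursion says that the decrements `f d
- f (d.remove i)` over the support sum to `1`, and by `greedyMax_remove_le` they are nonnegative. A
law with largest probability `q` therefore loses at most `q` on average, which Guesser's current
point makes up; induction gives `greedyMax_le_val`. The minimum is dual: the decrements sum to `1`
on full support and to `0` otherwise.

For the asymptotics, let each type still present be drawn at the rings of its own rate-1 Poisson
clock, so that type `i` runs out at a gamma time of shape `d i`. The best value is the expected
maximum of these times, the worst value their expected minimum. The maximum lies between a harmonic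
number and an exponential-moment bound, both `~ log n`. The minimum for a constant deck is `∫
gammaTail m t ^ n`; scaling `t = n^(-1/m) s` leads to `∫ exp (-s^m / m!)`. -/

/-! ### Decks and their supports -/

theorem Deck.mem_supp_iff {n : ℕ} {d : Deck n} {i : Fin n} : i ∈ d.supp ↔ 0 < d i := by
  simp [Deck.supp]

theorem Deck.remove_self {n : ℕ} (d : Deck n) (i : Fin n) : d.remove i i = d i - 1 := by
  simp [Deck.remove]

theorem Deck.remove_of_ne {n : ℕ} (d : Deck n) {i j : Fin n} (h : j ≠ i) :
    d.remove i j = d j := by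
  simp [Deck.remove, h]

theorem Deck.remove_comm {n : ℕ} (d : Deck n) (i j : Fin n) :
    (d.remove i).remove j = (d.remove j).remove i := by
  simp only [Deck.remove]
  exact tsub_right_comm

theorem Deck.remove_of_notMem {n : ℕ} {d : Deck n} {i : Fin n} (h : i ∉ d.supp) :
    d.remove i = d := by
  have h0 : d i = 0 := by simpa [Deck.supp] using h
  ext j
  by_cases hj : j = i
  · subst hj; simp [Deck.remove_self, h0]
  · exact Deck.remove_of_ne d hj

theorem Deck.induction {n : ℕ} {P : Deck n → Prop} (zero : P 0)
    (step : ∀ d : Deck n, d ≠ 0 → (∀ i ∈ d.supp, P (d.remove i)) → P d) (d : Deck n) : P d := by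
  induction h : ∑ j, d j using Nat.strong_induction_on generalizing d with
  | _ s ih =>
    by_cases hd : d = 0
    · exact hd ▸ zero
    · exact step d hd fun i hi => ih _ (h ▸ Deck.sum_remove_lt hi) _ rfl

theorem Deck.supp_remove_of_two_le {n : ℕ} {d : Deck n} {j : Fin n} (h : 2 ≤ d j) :
    (d.remove j).supp = d.supp := by
  ext i
  rw [Deck.mem_supp_iff, Deck.mem_supp_iff]
  by_cases hi : i = j
  · subst hi; rw [Deck.remove_self]; omega
  · rw [Deck.remove_of_ne d hi]

theorem Deck.supp_remove_of_eq_one {n : ℕ} {d : Deck n} {j : Fin n} (h : d j = 1) :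
    (d.remove j).supp = d.supp.erase j := by
  ext i
  rw [Finset.mem_erase, Deck.mem_supp_iff, Deck.mem_supp_iff]
  by_cases hi : i = j
  · subst hi; rw [Deck.remove_self]; simp [h]
  · rw [Deck.remove_of_ne d hi]; simp [hi]

theorem Deck.supp_remove_subset {n : ℕ} (d : Deck n) (j : Fin n) :
    (d.remove j).supp ⊆ d.supp := by
  intro i hi
  rw [Deck.mem_supp_iff] at *
  exact hi.trans_le (by simp [Deck.remove])

theorem Deck.card_supp_pos {n : ℕ} {d : Deck n} (hd : d ≠ 0) : (0 : ℝ) < d.supp.card := by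
  exact_mod_cast (Deck.supp_nonempty hd).card_pos

/-! ### One-step equation for the expected score -/

/-- The mean of a probability distribution on `ℕ`, as an extended non-negative real. -/
def emean (p : PMF ℕ) : ENNReal := ∑' c, p c * c

theorem emean_pure (k : ℕ) : emean (PMF.pure k) = k := by
  rw [emean, tsum_eq_single k]
  · simp
  · intro c hc; simp [hc]

theorem emean_bind {α : Type*} (p : PMF α) (q : α → PMF ℕ) :
    emean (p.bind q) = ∑' a, p a * emean (q a) := by
  simp only [emean, PMF.bind_apply, ← ENNReal.tsum_mul_right, ← ENNReal.tsum_mul_left]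
  rw [ENNReal.tsum_comm]
  simp only [mul_assoc]

theorem emean_map_add (p : PMF ℕ) (k : ℕ) : emean (p.map fun c => k + c) = k + emean p := by
  rw [← PMF.bind_pure_comp, emean_bind]
  simp only [Function.comp, emean_pure, Nat.cast_add, mul_add, ENNReal.tsum_add]
  rw [ENNReal.tsum_mul_right, p.tsum_coe, one_mul, emean]

theorem integral_toMeasure_eq_toReal_emean (p : PMF ℕ) :
    ∫ c, (c : ℝ) ∂p.toMeasure = (emean p).toReal := by
  rw [integral_eq_lintegral_of_nonneg_ae (Eventually.of_forall fun c => Nat.cast_nonneg c)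
    (measurable_from_top.aestronglyMeasurable), lintegral_countable']
  congr 1
  refine tsum_congr fun c => ?_
  rw [PMF.toMeasure_apply_singleton _ _ (measurableSet_singleton c), ENNReal.ofReal_natCast,
    mul_comm]

variable {n : ℕ} (G : GuesserStrategy) (S : ShufflerStrategy)

theorem score_eq_bind {d : Deck n} (hd : d ≠ 0) :
    score G S d = (S.law n d hd).bind fun i => (G n d hd).bind fun g =>
      (score G S (d.remove i)).map fun c => (if g = i then 1 else 0) + c := by
  rw [score, dif_neg hd]
  exact PMF.bindOnSupport_eq_bind _ _

theorem emean_score {d : Deck n} (hd : d ≠ 0) :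
    emean (score G S d) =
      ∑ i, S.law n d hd i * (G n d hd i + emean (score G S (d.remove i))) := by
  rw [score_eq_bind G S hd, emean_bind, tsum_fintype]
  refine Finset.sum_congr rfl fun i _ => ?_
  rw [emean_bind]
  simp only [emean_map_add, mul_add, ENNReal.tsum_add]
  rw [ENNReal.tsum_mul_right, PMF.tsum_coe, one_mul, tsum_eq_single i]
  · simp
  · intro j hj; simp [hj]

theorem law_eq_zero {d : Deck n} (hd : d ≠ 0) {i : Fin n} (hi : i ∉ d.supp) :
    S.law n d hd i = 0 := by
  by_contra h
  exact hi (S.mem_supp n d hd i ((PMF.mem_support_iff _ _).mpr h))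

/-- Needed to pass from extended to real values. Removing an absent card leaves the deck unchanged,
so that term escapes the induction; its probability is `0`. -/
theorem emean_score_ne_top (d : Deck n) : emean (score G S d) ≠ ⊤ := by
  induction d using Deck.induction with
  | zero => rw [score, dif_pos rfl, emean_pure]; simp
  | step d hd ih =>
    rw [emean_score G S hd]
    refine ENNReal.sum_ne_top.mpr fun i _ => ?_
    by_cases hi : i ∈ d.supp
    · exact ENNReal.mul_ne_top (PMF.apply_ne_top _ _)
        (ENNReal.add_ne_top.mpr ⟨PMF.apply_ne_top _ _, ih i hi⟩)
    · simp [law_eq_zero S hd hi]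

/-- Guesser's expected score from the deck `d`. -/
def val (d : Deck n) : ℝ := (emean (score G S d)).toReal

theorem expScore_eq_val (m n : ℕ) : expScore m n G S = val G S (fun _ : Fin n => m) :=
  integral_toMeasure_eq_toReal_emean _

theorem val_zero : val G S (0 : Deck n) = 0 := by
  rw [val, score, dif_pos rfl, emean_pure]; simp

theorem val_nonneg (d : Deck n) : 0 ≤ val G S d := ENNReal.toReal_nonneg

theorem val_eq {d : Deck n} (hd : d ≠ 0) :
    val G S d = ∑ i, (S.law n d hd i).toReal * ((G n d hd i).toReal + val G S (d.remove i)) := by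
  rw [val, emean_score G S hd, ENNReal.toReal_sum]
  · refine Finset.sum_congr rfl fun i _ => ?_
    rw [ENNReal.toReal_mul, ENNReal.toReal_add (PMF.apply_ne_top _ _) (emean_score_ne_top G S _),
      val]
  · intro i _
    exact ENNReal.mul_ne_top (PMF.apply_ne_top _ _)
      (ENNReal.add_ne_top.mpr ⟨PMF.apply_ne_top _ _, emean_score_ne_top G S _⟩)

theorem sum_toReal_pmf (p : PMF (Fin n)) : ∑ i, (p i).toReal = 1 := by
  rw [← ENNReal.toReal_sum fun i _ => PMF.apply_ne_top _ _,
    ← tsum_fintype (L := .unconditional _), p.tsum_coe,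
    ENNReal.toReal_one]

/-! ### Myopic replies of Guesser -/

theorem exists_forall_law_le {d : Deck n} (hd : d ≠ 0) :
    ∃ i, ∀ j, (S.law n d hd j).toReal ≤ (S.law n d hd i).toReal := by
  have : Nonempty (Fin n) := ⟨(Deck.supp_nonempty hd).choose⟩
  exact Finite.exists_max fun i => (S.law n d hd i).toReal

theorem exists_forall_le_law {d : Deck n} (hd : d ≠ 0) :
    ∃ i, ∀ j, (S.law n d hd i).toReal ≤ (S.law n d hd j).toReal := by
  have : Nonempty (Fin n) := ⟨(Deck.supp_nonempty hd).choose⟩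
  exact Finite.exists_min fun i => (S.law n d hd i).toReal

/-- The Guesser strategy that always guesses a card type Shuffler is most likely to draw. -/
def bestReply : GuesserStrategy := fun _ _ hd => PMF.pure (exists_forall_law_le S hd).choose

/-- The Guesser strategy that always guesses a card type Shuffler is least likely to draw. -/
def worstReply : GuesserStrategy := fun _ _ hd => PMF.pure (exists_forall_le_law S hd).choose

/-- The largest probability of a card type in Shuffler's next draw. -/
def maxProb {d : Deck n} (hd : d ≠ 0) : ℝ :=
  (S.law n d hd (exists_forall_law_le S hd).choose).toReal

/-- The smallest probability of a card type in Shuffler's next draw. -/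
def minProb {d : Deck n} (hd : d ≠ 0) : ℝ :=
  (S.law n d hd (exists_forall_le_law S hd).choose).toReal

theorem law_le_maxProb {d : Deck n} (hd : d ≠ 0) (i : Fin n) :
    (S.law n d hd i).toReal ≤ maxProb S hd :=
  (exists_forall_law_le S hd).choose_spec i

theorem minProb_le_law {d : Deck n} (hd : d ≠ 0) (i : Fin n) :
    minProb S hd ≤ (S.law n d hd i).toReal :=
  (exists_forall_le_law S hd).choose_spec i

theorem minProb_nonneg {d : Deck n} (hd : d ≠ 0) : 0 ≤ minProb S hd := ENNReal.toReal_nonneg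

theorem sum_mul_pure (w : Fin n → ℝ) (j : Fin n) :
    ∑ i, w i * (PMF.pure j i).toReal = w j := by
  rw [Finset.sum_eq_single j] <;> simp +contextual

theorem val_bestReply {d : Deck n} (hd : d ≠ 0) :
    val (bestReply S) S d =
      maxProb S hd + ∑ i, (S.law n d hd i).toReal * val (bestReply S) S (d.remove i) := by
  rw [val_eq _ _ hd]
  simp only [mul_add, Finset.sum_add_distrib]
  congr 1
  exact sum_mul_pure _ _

theorem val_worstReply {d : Deck n} (hd : d ≠ 0) :
    val (worstReply S) S d =
      minProb S hd + ∑ i, (S.law n d hd i).toReal * val (worstReply S) S (d.remove i) := by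
  rw [val_eq _ _ hd]
  simp only [mul_add, Finset.sum_add_distrib]
  congr 1
  exact sum_mul_pure _ _

theorem sum_law_mul_le_sum_law_mul {d : Deck n} (hd : d ≠ 0) {u v : Fin n → ℝ}
    (h : ∀ i ∈ d.supp, u i ≤ v i) :
    ∑ i, (S.law n d hd i).toReal * u i ≤ ∑ i, (S.law n d hd i).toReal * v i := by
  refine Finset.sum_le_sum fun i _ => ?_
  by_cases hi : i ∈ d.supp
  · exact mul_le_mul_of_nonneg_left (h i hi) ENNReal.toReal_nonneg
  · simp [law_eq_zero S hd hi]

/-- The current point and the continuation are bounded separately, because the next deck does not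
depend on the guess. -/
theorem val_le_val_bestReply (d : Deck n) : val G S d ≤ val (bestReply S) S d := by
  induction d using Deck.induction with
  | zero => rw [val_zero, val_zero]
  | step d hd ih =>
    rw [val_eq _ _ hd, val_bestReply S hd]
    simp only [mul_add, Finset.sum_add_distrib]
    refine add_le_add ?_ (sum_law_mul_le_sum_law_mul S hd ih)
    calc _ ≤ ∑ i, maxProb S hd * (G n d hd i).toReal := Finset.sum_le_sum fun i _ =>
          mul_le_mul_of_nonneg_right (law_le_maxProb S hd i) ENNReal.toReal_nonneg
      _ = maxProb S hd := by rw [← Finset.mul_sum, sum_toReal_pmf, mul_one]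

theorem val_worstReply_le_val (d : Deck n) : val (worstReply S) S d ≤ val G S d := by
  induction d using Deck.induction with
  | zero => rw [val_zero, val_zero]
  | step d hd ih =>
    rw [val_eq G _ hd, val_worstReply S hd]
    simp only [mul_add, Finset.sum_add_distrib]
    refine add_le_add ?_ (sum_law_mul_le_sum_law_mul S hd ih)
    calc minProb S hd = ∑ i, minProb S hd * (G n d hd i).toReal := by
          rw [← Finset.mul_sum, sum_toReal_pmf, mul_one]
      _ ≤ _ := Finset.sum_le_sum fun i _ =>
          mul_le_mul_of_nonneg_right (minProb_le_law S hd i) ENNReal.toReal_nonneg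

/-! ### Values against the greedy Shuffler -/

/-- The best expected score of Guesser against the greedy Shuffler. -/
def greedyMax (d : Deck n) : ℝ := val (bestReply greedy) greedy d

/-- The worst expected score of Guesser against the greedy Shuffler. -/
def greedyMin (d : Deck n) : ℝ := val (worstReply greedy) greedy d

theorem greedy_law {d : Deck n} (hd : d ≠ 0) (i : Fin n) :
    (greedy.law n d hd i).toReal = if i ∈ d.supp then (d.supp.card : ℝ)⁻¹ else 0 := by
  simp only [greedy, PMF.uniformOfFinset_apply]
  split_ifs <;> simp

theorem sum_greedy_law_mul {d : Deck n} (hd : d ≠ 0) (w : Fin n → ℝ) :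
    ∑ i, (greedy.law n d hd i).toReal * w i = (d.supp.card : ℝ)⁻¹ * ∑ i ∈ d.supp, w i := by
  simp only [greedy_law, ite_mul, zero_mul]
  rw [Finset.sum_ite_mem, Finset.univ_inter, Finset.mul_sum]

theorem maxProb_greedy {d : Deck n} (hd : d ≠ 0) :
    maxProb greedy hd = (d.supp.card : ℝ)⁻¹ := by
  obtain ⟨i, hi⟩ := Deck.supp_nonempty hd
  refine le_antisymm ?_ ?_
  · rw [maxProb, greedy_law]
    split_ifs
    · exact le_rfl
    · positivity
  · have := law_le_maxProb greedy hd i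
    rwa [greedy_law, if_pos hi] at this

theorem minProb_greedy {d : Deck n} (hd : d ≠ 0) :
    minProb greedy hd = if d.supp = Finset.univ then (d.supp.card : ℝ)⁻¹ else 0 := by
  split_ifs with h
  · rw [minProb, greedy_law, if_pos (h ▸ Finset.mem_univ _)]
  · obtain ⟨i, hi⟩ : ∃ i, i ∉ d.supp := by
      by_contra! hc
      exact h (Finset.eq_univ_of_forall hc)
    refine le_antisymm ?_ (minProb_nonneg _ _)
    have := minProb_le_law greedy hd i
    rwa [greedy_law, if_neg hi] at this

theorem greedyMax_zero : greedyMax (0 : Deck n) = 0 := val_zero _ _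

theorem greedyMin_zero : greedyMin (0 : Deck n) = 0 := val_zero _ _

theorem greedyMax_nonneg (d : Deck n) : 0 ≤ greedyMax d := val_nonneg _ _ _

theorem greedyMin_nonneg (d : Deck n) : 0 ≤ greedyMin d := val_nonneg _ _ _

theorem card_mul_greedyMax {d : Deck n} (hd : d ≠ 0) :
    d.supp.card * greedyMax d = 1 + ∑ i ∈ d.supp, greedyMax (d.remove i) := by
  have hk := (Deck.card_supp_pos hd).ne'
  rw [greedyMax, val_bestReply _ hd, sum_greedy_law_mul, maxProb_greedy, ← mul_one_add,
    mul_inv_cancel_left₀ hk]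
  rfl

theorem card_mul_greedyMin {d : Deck n} (hd : d ≠ 0) :
    d.supp.card * greedyMin d =
      (if d.supp = Finset.univ then 1 else 0) + ∑ i ∈ d.supp, greedyMin (d.remove i) := by
  have hk := (Deck.card_supp_pos hd).ne'
  rw [greedyMin, val_worstReply _ hd, sum_greedy_law_mul, minProb_greedy]
  split_ifs
  · rw [← mul_one_add, mul_inv_cancel_left₀ hk]; rfl
  · rw [zero_add, zero_add, mul_inv_cancel_left₀ hk]; rfl

theorem greedyMax_remove_le (d : Deck n) (j : Fin n) : greedyMax (d.remove j) ≤ greedyMax d := by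
  induction d using Deck.induction generalizing j with
  | zero => rw [Deck.remove_of_notMem (by simp [Deck.supp])]
  | step d hd ih =>
    by_cases hj : j ∈ d.supp
    swap
    · rw [Deck.remove_of_notMem hj]
    by_cases h0 : d.remove j = 0
    · rw [h0, greedyMax_zero]; exact greedyMax_nonneg d
    have hk := Deck.card_supp_pos hd
    have e := card_mul_greedyMax hd
    have e' := card_mul_greedyMax h0
    refine le_of_mul_le_mul_left ?_ hk
    rcases (Nat.succ_le_of_lt (Deck.mem_supp_iff.mp hj)).eq_or_lt with h1 | h2
    -- The last copy of `j` goes, so the recursion for `d.remove j` has factor `k - 1`; the missing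
    -- copy of `greedyMax (d.remove j)` is the `j`-term of the recursion for `d`.
    · rw [Deck.supp_remove_of_eq_one h1.symm, Finset.card_erase_of_mem hj,
        Nat.cast_sub (Finset.card_pos.mpr ⟨j, hj⟩)] at e'
      rw [e, ← Finset.add_sum_erase _ _ hj]
      have : ∑ i ∈ d.supp.erase j, greedyMax ((d.remove j).remove i) ≤
          ∑ i ∈ d.supp.erase j, greedyMax (d.remove i) :=
        Finset.sum_le_sum fun i hi => by
          rw [Deck.remove_comm]; exact ih i (Finset.mem_of_mem_erase hi) j
      push_cast at e'
      linarith
    · rw [Deck.supp_remove_of_two_le h2] at e'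
      rw [e, e']
      gcongr with i hi
      rw [Deck.remove_comm]
      exact ih i hi j

/-- Once a type is exhausted, Guesser can name it forever and never score. -/
theorem greedyMin_eq_zero (d : Deck n) (h : d.supp ≠ Finset.univ) : greedyMin d = 0 := by
  induction d using Deck.induction with
  | zero => exact greedyMin_zero
  | step d hd ih =>
    have e := card_mul_greedyMin hd
    rw [if_neg h, zero_add, Finset.sum_eq_zero] at e
    · exact (mul_eq_zero.mp e).resolve_left (Deck.card_supp_pos hd).ne'
    · exact fun i hi => ih i hi fun hu =>
        h (Finset.univ_subset_iff.mp (hu ▸ Deck.supp_remove_subset d i))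

theorem greedyMin_remove_le (d : Deck n) (j : Fin n) : greedyMin (d.remove j) ≤ greedyMin d := by
  induction d using Deck.induction generalizing j with
  | zero => rw [Deck.remove_of_notMem (by simp [Deck.supp])]
  | step d hd ih =>
    by_cases hj : j ∈ d.supp
    swap
    · rw [Deck.remove_of_notMem hj]
    by_cases h0 : d.remove j = 0
    · rw [h0, greedyMin_zero]; exact greedyMin_nonneg d
    rcases (Nat.succ_le_of_lt (Deck.mem_supp_iff.mp hj)).eq_or_lt with h1 | h2
    · rw [greedyMin_eq_zero (d.remove j)]
      · exact greedyMin_nonneg d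
      · rw [Deck.supp_remove_of_eq_one h1.symm]
        intro hu
        exact Finset.notMem_erase j d.supp (hu ▸ Finset.mem_univ j)
    · have e := card_mul_greedyMin hd
      have e' := card_mul_greedyMin h0
      refine le_of_mul_le_mul_left ?_ (Deck.card_supp_pos hd)
      rw [Deck.supp_remove_of_two_le h2] at e'
      rw [e, e']
      gcongr with i hi
      rw [Deck.remove_comm]
      exact ih i hi j

/-! ### Optimality of the greedy Shuffler -/

theorem sum_law_mul_sub {d : Deck n} (hd : d ≠ 0) (a : ℝ) (w : Fin n → ℝ) :
    ∑ i, (S.law n d hd i).toReal * w i =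
      a - ∑ i ∈ d.supp, (S.law n d hd i).toReal * (a - w i) := by
  have : ∑ i ∈ d.supp, (S.law n d hd i).toReal * (a - w i) =
      ∑ i, (S.law n d hd i).toReal * (a - w i) :=
    Finset.sum_subset (Finset.subset_univ _) fun i _ hi => by simp [law_eq_zero S hd hi]
  rw [this]
  simp only [mul_sub, Finset.sum_sub_distrib]
  rw [← Finset.sum_mul, sum_toReal_pmf]
  ring

/-- The decrements of `greedyMax` are nonnegative with sum `1`, so their average under any law is at
most its largest probability. -/
theorem greedyMax_le_val (d : Deck n) : greedyMax d ≤ val (bestReply S) S d := by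
  induction d using Deck.induction with
  | zero => rw [greedyMax_zero, val_zero]
  | step d hd ih =>
    have e := card_mul_greedyMax hd
    rw [val_bestReply S hd]
    refine le_trans ?_ (add_le_add_right (sum_law_mul_le_sum_law_mul S hd ih) _)
    rw [sum_law_mul_sub S hd (greedyMax d)]
    have : ∑ i ∈ d.supp, (S.law n d hd i).toReal * (greedyMax d - greedyMax (d.remove i)) ≤
        ∑ i ∈ d.supp, maxProb S hd * (greedyMax d - greedyMax (d.remove i)) :=
      Finset.sum_le_sum fun i _ => mul_le_mul_of_nonneg_right (law_le_maxProb S hd i)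
        (sub_nonneg.mpr (greedyMax_remove_le d i))
    rw [← Finset.mul_sum, Finset.sum_sub_distrib, Finset.sum_const, nsmul_eq_mul, e,
      add_sub_cancel_right, mul_one] at this
    linarith

theorem val_le_greedyMin (d : Deck n) : val (worstReply S) S d ≤ greedyMin d := by
  induction d using Deck.induction with
  | zero => rw [greedyMin_zero, val_zero]
  | step d hd ih =>
    have e := card_mul_greedyMin hd
    rw [val_worstReply S hd]
    refine le_trans (add_le_add_right (sum_law_mul_le_sum_law_mul S hd ih) _) ?_
    rw [sum_law_mul_sub S hd (greedyMin d)]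
    have : ∑ i ∈ d.supp, minProb S hd * (greedyMin d - greedyMin (d.remove i)) ≤
        ∑ i ∈ d.supp, (S.law n d hd i).toReal * (greedyMin d - greedyMin (d.remove i)) :=
      Finset.sum_le_sum fun i _ => mul_le_mul_of_nonneg_right (minProb_le_law S hd i)
        (sub_nonneg.mpr (greedyMin_remove_le d i))
    rw [← Finset.mul_sum, Finset.sum_sub_distrib, Finset.sum_const, nsmul_eq_mul, e,
      add_sub_cancel_right] at this
    split_ifs at this with h
    · linarith
    -- A missing type forces the smallest probability to be `0`.
    · obtain ⟨i, hi⟩ : ∃ i, i ∉ d.supp := by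
        by_contra! hc
        exact h (Finset.eq_univ_of_forall hc)
      have h0 := minProb_le_law S hd i
      rw [law_eq_zero S hd hi, ENNReal.toReal_zero] at h0
      linarith

theorem isGreatest_expScore (m n : ℕ) (S : ShufflerStrategy) :
    IsGreatest (Set.range fun G => expScore m n G S) (val (bestReply S) S fun _ : Fin n => m) := by
  simp only [expScore_eq_val]
  refine ⟨⟨_, rfl⟩, ?_⟩
  rintro _ ⟨G, rfl⟩
  exact val_le_val_bestReply G S _

theorem isLeast_expScore (m n : ℕ) (S : ShufflerStrategy) :
    IsLeast (Set.range fun G => expScore m n G S) (val (worstReply S) S fun _ : Fin n => m) := by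
  simp only [expScore_eq_val]
  refine ⟨⟨_, rfl⟩, ?_⟩
  rintro _ ⟨G, rfl⟩
  exact val_worstReply_le_val G S _

theorem maxScore_eq (m n : ℕ) (S : ShufflerStrategy) :
    maxScore m n S = val (bestReply S) S fun _ : Fin n => m :=
  (isGreatest_expScore m n S).csSup_eq

theorem minScore_eq (m n : ℕ) (S : ShufflerStrategy) :
    minScore m n S = val (worstReply S) S fun _ : Fin n => m :=
  (isLeast_expScore m n S).csInf_eq

theorem isLeast_maxScore (m n : ℕ) :
    IsLeast (Set.range fun S => maxScore m n S) (greedyMax fun _ : Fin n => m) := by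
  simp only [maxScore_eq]
  refine ⟨⟨greedy, rfl⟩, ?_⟩
  rintro _ ⟨S, rfl⟩
  exact greedyMax_le_val S _

theorem isGreatest_minScore (m n : ℕ) :
    IsGreatest (Set.range fun S => minScore m n S) (greedyMin fun _ : Fin n => m) := by
  simp only [minScore_eq]
  refine ⟨⟨greedy, rfl⟩, ?_⟩
  rintro _ ⟨S, rfl⟩
  exact val_le_greedyMin S _

theorem minMaxScore_eq (m n : ℕ) : minMaxScore m n = greedyMax fun _ : Fin n => m :=
  (isLeast_maxScore m n).csInf_eq

theorem maxMinScore_eq (m n : ℕ) : maxMinScore m n = greedyMin fun _ : Fin n => m :=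
  (isGreatest_minScore m n).csSup_eq

/-! ### Logarithmic asymptotics of the maximum -/

theorem harmonic_card_supp_le_greedyMax (d : Deck n) :
    ((harmonic d.supp.card : ℚ) : ℝ) ≤ greedyMax d := by
  induction d using Deck.induction with
  | zero => simp [Deck.supp, greedyMax_zero]
  | step d hd ih =>
    have hk := Deck.card_supp_pos hd
    obtain ⟨k, hk1⟩ := Nat.exists_eq_succ_of_ne_zero (Deck.supp_nonempty hd).card_pos.ne'
    have hs : ∀ i ∈ d.supp, ((harmonic k : ℚ) : ℝ) ≤ greedyMax (d.remove i) := fun i hi => by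
      refine le_trans ?_ (ih i hi)
      rcases (Nat.succ_le_of_lt (Deck.mem_supp_iff.mp hi)).eq_or_lt with h1 | h2
      · rw [Deck.supp_remove_of_eq_one h1.symm, Finset.card_erase_of_mem hi, hk1]
        rfl
      · rw [Deck.supp_remove_of_two_le h2, hk1, Nat.succ_eq_add_one, harmonic_succ]
        push_cast
        have : (0 : ℝ) ≤ ((k : ℝ) + 1)⁻¹ := by positivity
        linarith
    have e := card_mul_greedyMax hd
    have h := Finset.sum_le_sum hs
    rw [Finset.sum_const, nsmul_eq_mul] at h
    refine le_of_mul_le_mul_left ?_ hk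
    rw [e]
    refine le_trans (le_of_eq ?_) (add_le_add_right h 1)
    rw [hk1, Nat.succ_eq_add_one, harmonic_succ]
    push_cast
    field_simp
    ring

theorem Deck.supp_eq_singleton_of_remove_eq_zero {d : Deck n} {i : Fin n} (hd : d ≠ 0)
    (h : d.remove i = 0) : d.supp = {i} ∧ d i = 1 := by
  have hj : ∀ j, j ≠ i → d j = 0 := fun j hj => by
    rw [← Deck.remove_of_ne d hj, h]; rfl
  have hi : d i - 1 = 0 := by rw [← Deck.remove_self, h]; rfl
  have hi0 : d i ≠ 0 := fun h0 => hd <| by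
    ext j
    by_cases hji : j = i
    · rw [hji, h0]; rfl
    · rw [hj j hji]; rfl
  refine ⟨?_, by omega⟩
  ext j
  rw [Deck.mem_supp_iff, Finset.mem_singleton]
  constructor
  · intro h1
    by_contra hji
    exact h1.ne' (hj j hji)
  · rintro rfl
    omega

theorem Deck.supp_const (n : ℕ) {m : ℕ} (hm : 1 ≤ m) :
    Deck.supp (fun _ : Fin n => m) = Finset.univ :=
  Finset.eq_univ_of_forall fun _ => Deck.mem_supp_iff.mpr hm

/-- With `T` the maximum of the gamma times `T_i`, this is `exp (l E T) ≤ E exp (l T) ≤ ∑ E exp (l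
T_i)`, each term being a gamma moment generating function. The proof runs the argument through the
recursion. -/
theorem exp_mul_greedyMax_le {l : ℝ} (h1 : l < 1) (d : Deck n) (hd : d ≠ 0) :
    Real.exp (l * greedyMax d) ≤ ∑ i ∈ d.supp, ((1 - l)⁻¹) ^ d i := by
  have hr : 0 < (1 - l)⁻¹ := inv_pos.mpr (by linarith)
  have hr1 : (1 - l)⁻¹ * (1 - l) = 1 := inv_mul_cancel₀ (by linarith)
  induction d using Deck.induction with
  | zero => exact absurd rfl hd
  | step d _ ih =>
    have hk := Deck.card_supp_pos hd
    have e := card_mul_greedyMax hd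
    -- The bound fails for the empty deck (`1 ≤ 0`), so a deck with a single card is treated
    -- directly.
    by_cases hz : ∃ i, d.remove i = 0
    · obtain ⟨i, hi⟩ := hz
      obtain ⟨hs, hdi⟩ := Deck.supp_eq_singleton_of_remove_eq_zero hd hi
      rw [hs, Finset.sum_singleton, hi, greedyMax_zero, Finset.card_singleton] at e
      rw [hs, Finset.sum_singleton, hdi, show greedyMax d = 1 by simpa using e, mul_one, pow_one,
        ← inv_inv (Real.exp l), ← Real.exp_neg]
      exact inv_anti₀ (by linarith) (Real.one_sub_le_exp_neg l)
    · push Not at hz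
      set A := ∑ i ∈ d.supp, ((1 - l)⁻¹) ^ d i with hA
      set k : ℝ := (d.supp.card : ℝ)
      -- Removing a copy multiplies one term of `A` by `1 - l`. If it was the last copy, the term
      -- becomes `1` and is kept although it left the support, which only weakens the bound.
      have hstep : ∀ i ∈ d.supp, Real.exp (l * greedyMax (d.remove i)) ≤
          A - l * ((1 - l)⁻¹) ^ d i := fun i hi => by
        have hdi := Deck.mem_supp_iff.mp hi
        calc _ ≤ ∑ j ∈ (d.remove i).supp, ((1 - l)⁻¹) ^ (d.remove i j) := ih i hi (hz i)
          _ ≤ ∑ j ∈ d.supp, ((1 - l)⁻¹) ^ (d.remove i j) :=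
            Finset.sum_le_sum_of_subset_of_nonneg (Deck.supp_remove_subset d i)
              fun _ _ _ => by positivity
          _ = A - l * ((1 - l)⁻¹) ^ d i := by
            rw [hA, ← Finset.add_sum_erase _ _ hi, ← Finset.add_sum_erase _ _ hi,
              Deck.remove_self, Finset.sum_congr rfl fun j hj => by
                rw [Deck.remove_of_ne d (Finset.ne_of_mem_erase hj)]]
            obtain ⟨c, hc⟩ := Nat.exists_eq_succ_of_ne_zero hdi.ne'
            rw [hc, Nat.succ_eq_add_one, Nat.add_sub_cancel, pow_succ]
            linear_combination (-(1 - l)⁻¹ ^ c) * hr1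
      have hsum : ∑ i ∈ d.supp, Real.exp (l * greedyMax (d.remove i)) ≤ k * A - l * A := by
        refine (Finset.sum_le_sum hstep).trans_eq ?_
        rw [Finset.sum_sub_distrib, Finset.sum_const, nsmul_eq_mul, ← Finset.mul_sum]
      have hA0 : 0 ≤ A := Finset.sum_nonneg fun _ _ => by positivity
      -- Jensen for the uniform draw.
      have hJ := convexOn_exp.map_sum_le (t := d.supp) (w := fun _ => k⁻¹)
        (p := fun i => l * greedyMax (d.remove i)) (fun _ _ => by positivity)
        (by rw [Finset.sum_const, nsmul_eq_mul]; exact mul_inv_cancel₀ hk.ne')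
        (fun _ _ => Set.mem_univ _)
      simp only [smul_eq_mul] at hJ
      rw [← Finset.mul_sum, ← Finset.mul_sum, ← Finset.mul_sum] at hJ
      have hf : l * greedyMax d =
          l / k + k⁻¹ * (l * ∑ i ∈ d.supp, greedyMax (d.remove i)) := by
        have : greedyMax d = k⁻¹ * (1 + ∑ i ∈ d.supp, greedyMax (d.remove i)) := by
          rw [← e, inv_mul_cancel_left₀ hk.ne']
        rw [this]; ring
      have hexp : 1 - l / k ≤ Real.exp (-(l / k)) := Real.one_sub_le_exp_neg _
      calc Real.exp (l * greedyMax d)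
          = Real.exp (l / k) * Real.exp (k⁻¹ * (l * ∑ i ∈ d.supp, greedyMax (d.remove i))) := by
            rw [hf, Real.exp_add]
        _ ≤ Real.exp (l / k) * (k⁻¹ * (k * A - l * A)) := by
            gcongr
            exact hJ.trans (by gcongr)
        _ = Real.exp (l / k) * ((1 - l / k) * A) := by field_simp
        _ ≤ Real.exp (l / k) * (Real.exp (-(l / k)) * A) := by gcongr
        _ = A := by rw [← mul_assoc, ← Real.exp_add, add_neg_cancel, Real.exp_zero, one_mul]

theorem greedyMax_const_le (m : ℕ) (hm : 1 ≤ m) (hn : 1 ≤ n) {l : ℝ} (h0 : 0 < l) (h1 : l < 1) :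
    greedyMax (fun _ : Fin n => m) ≤ l⁻¹ * (Real.log n + m * Real.log (1 - l)⁻¹) := by
  have hr : 0 < (1 - l)⁻¹ := inv_pos.mpr (by linarith)
  have hn0 : (0 : ℝ) < n := by exact_mod_cast hn
  have h := exp_mul_greedyMax_le h1 (fun _ : Fin n => m)
    (fun h => by have := congrFun h ⟨0, hn⟩; simp only [Pi.zero_apply] at this; omega)
  rw [Deck.supp_const n hm, Finset.sum_const, Finset.card_univ, Fintype.card_fin, nsmul_eq_mul,
    ← Real.le_log_iff_exp_le (by positivity), Real.log_mul hn0.ne' (by positivity),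
    Real.log_pow] at h
  rw [inv_mul_eq_div, le_div_iff₀ h0, mul_comm]
  exact h

theorem greedyMax_const_isEquivalent (m : ℕ) (hm : 1 ≤ m) :
    (fun n : ℕ => greedyMax fun _ : Fin n => m) ~[atTop] fun n : ℕ => Real.log n := by
  have hL : Tendsto (fun n : ℕ => Real.log n) atTop atTop :=
    Real.tendsto_log_atTop.comp tendsto_natCast_atTop_atTop
  refine isEquivalent_of_tendsto_one ?_
  have hlim : Tendsto (fun x : ℝ => (1 + x⁻¹) * (1 + m * (Real.log (1 + x) / x))) atTop (nhds 1) := by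
    have h1 : Tendsto (fun x : ℝ => x⁻¹) atTop (nhds 0) := tendsto_inv_atTop_zero
    have h2 : Tendsto (fun x : ℝ => Real.log (1 + x) / x) atTop (nhds 0) := by
      have h3 : Tendsto (fun x : ℝ => Real.log (1 + x) / (1 + x)) atTop (nhds 0) :=
        (Real.isLittleO_log_id_atTop.tendsto_div_nhds_zero).comp
          (tendsto_atTop_add_const_left _ 1 tendsto_id)
      have h4 : Tendsto (fun x : ℝ => Real.log (1 + x) / (1 + x) * (1 + x⁻¹)) atTop
          (nhds (0 * (1 + 0))) := h3.mul (h1.const_add 1)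
      rw [zero_mul] at h4
      refine h4.congr' ?_
      filter_upwards [eventually_gt_atTop 0] with x hx
      field_simp
      ring
    simpa using (h1.const_add 1).mul ((h2.const_mul (m : ℝ)).const_add 1)
  refine tendsto_of_tendsto_of_tendsto_of_le_of_le' tendsto_const_nhds (hlim.comp hL) ?_ ?_
  · filter_upwards [hL.eventually_gt_atTop 0] with n hn
    rw [Pi.div_apply, le_div_iff₀ hn, one_mul]
    have h := harmonic_card_supp_le_greedyMax (fun _ : Fin n => m)
    rw [Deck.supp_const n hm, Finset.card_univ, Fintype.card_fin] at h
    refine le_trans ?_ ((log_add_one_le_harmonic n).trans h)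
    have hn0 : 0 < n := by
      rcases Nat.eq_zero_or_pos n with rfl | h
      · simp at hn
      · exact h
    exact Real.log_le_log (by exact_mod_cast hn0) (by exact_mod_cast n.le_succ)
  · filter_upwards [hL.eventually_gt_atTop 0, eventually_ge_atTop 1] with n hn hn1
    set L := Real.log n with hLdef
    -- This `l` tends to `1` while `(1 - l)⁻¹ = 1 + L`, so the correction `m log (1 + L)` is
    -- negligible against `L`.
    have h := greedyMax_const_le m hm hn1 (l := L / (1 + L)) (by positivity)
      (by rw [div_lt_one (by positivity)]; linarith)
    have e : (1 - L / (1 + L))⁻¹ = 1 + L := by field_simp; ring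
    rw [e] at h
    simp only [Pi.div_apply, Function.comp_apply, ← hLdef]
    rw [div_le_iff₀ hn]
    refine h.trans_eq ?_
    rw [← hLdef]
    field_simp
    ring

/-! ### The minimum as an integral of gamma tails -/

/-- The probability that a sum of `k` independent standard exponential variables exceeds `t`. -/
def gammaTail (k : ℕ) (t : ℝ) : ℝ := Real.exp (-t) * ∑ j ∈ Finset.range k, t ^ j / j.factorial

theorem gammaTail_zero (t : ℝ) : gammaTail 0 t = 0 := by simp [gammaTail]

theorem gammaTail_succ (k : ℕ) (t : ℝ) :
    gammaTail (k + 1) t = gammaTail k t + Real.exp (-t) * (t ^ k / k.factorial) := by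
  rw [gammaTail, Finset.sum_range_succ, mul_add, gammaTail]

theorem gammaTail_apply_zero {k : ℕ} (hk : 0 < k) : gammaTail k 0 = 1 := by
  obtain ⟨k, rfl⟩ := Nat.exists_eq_succ_of_ne_zero hk.ne'
  simp [gammaTail, Finset.sum_range_succ']

theorem gammaTail_nonneg (k : ℕ) {t : ℝ} (ht : 0 ≤ t) : 0 ≤ gammaTail k t :=
  mul_nonneg (Real.exp_pos _).le (Finset.sum_nonneg fun _ _ => by positivity)

theorem gammaTail_le_one (k : ℕ) {t : ℝ} (ht : 0 ≤ t) : gammaTail k t ≤ 1 := by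
  calc gammaTail k t ≤ Real.exp (-t) * Real.exp t :=
        mul_le_mul_of_nonneg_left (Real.sum_le_exp_of_nonneg ht k) (Real.exp_pos _).le
    _ = 1 := by rw [← Real.exp_add, neg_add_cancel, Real.exp_zero]

theorem continuous_gammaTail (k : ℕ) : Continuous (gammaTail k) := by
  unfold gammaTail
  fun_prop

/-- Minus the gamma density is a difference of consecutive tails. Truncated subtraction is harmless
at `k = 0`, where the tail vanishes identically. -/
theorem hasDerivAt_gammaTail (k : ℕ) (t : ℝ) :
    HasDerivAt (gammaTail k) (gammaTail (k - 1) t - gammaTail k t) t := by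
  have hexp : HasDerivAt (fun t : ℝ => Real.exp (-t)) (-Real.exp (-t)) t := by
    simpa using (hasDerivAt_neg t).exp
  induction k with
  | zero =>
    have : gammaTail 0 = fun _ => 0 := funext gammaTail_zero
    rw [this]
    simpa using hasDerivAt_const t (0 : ℝ)
  | succ k ih =>
    have hfun : gammaTail (k + 1) =
        fun t => gammaTail k t + Real.exp (-t) * (t ^ k / k.factorial) :=
      funext (gammaTail_succ k)
    have h := ih.add (hexp.mul ((hasDerivAt_pow k t).div_const (k.factorial : ℝ)))
    rw [hfun]
    refine h.congr_deriv ?_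
    rcases k with _ | k
    · simp [gammaTail_zero]
    · simp only [Nat.add_sub_cancel, gammaTail_succ]
      rw [Nat.factorial_succ]
      push_cast
      field_simp
      ring

theorem tendsto_gammaTail_atTop (k : ℕ) : Tendsto (gammaTail k) atTop (nhds 0) := by
  induction k with
  | zero =>
    have : gammaTail 0 = fun _ => 0 := funext gammaTail_zero
    rw [this]
    exact tendsto_const_nhds
  | succ k ih =>
    have h := ih.add ((Real.tendsto_pow_mul_exp_neg_atTop_nhds_zero k).div_const (k.factorial : ℝ))
    rw [zero_div, add_zero] at h
    refine h.congr fun t => ?_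
    rw [gammaTail_succ]
    ring

theorem integrableOn_gammaTail (k : ℕ) : IntegrableOn (gammaTail k) (Set.Ioi 0) := by
  induction k with
  | zero =>
    have : gammaTail 0 = fun _ => 0 := funext gammaTail_zero
    rw [this]
    exact integrableOn_zero
  | succ k ih =>
    have h := (Real.GammaIntegral_convergent (s := k + 1) (by positivity)).div_const
      (k.factorial : ℝ)
    refine (ih.add h).congr_fun (fun t _ => ?_) measurableSet_Ioi
    simp only [Pi.add_apply, gammaTail_succ, add_sub_cancel_right, Real.rpow_natCast]
    ring

/-- The probability that independent gamma variables, the `i`-th one of shape `d i`, all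
exceed `t`. -/
def jointTail (d : Deck n) (t : ℝ) : ℝ := ∏ i, gammaTail (d i) t

/-- The expected minimum of independent gamma variables, the `i`-th one of shape `d i`. -/
def meanMin (d : Deck n) : ℝ := ∫ t in Set.Ioi 0, jointTail d t

/-- One factor dominates the product. For `n = 0` the product is `1`, which is not integrable. -/
theorem integrableOn_jointTail (hn : 0 < n) (d : Deck n) :
    IntegrableOn (jointTail d) (Set.Ioi 0) := by
  refine Integrable.mono' (integrableOn_gammaTail (d ⟨0, hn⟩))
    (continuous_finsetProd _ fun i _ => continuous_gammaTail (d i)).aestronglyMeasurable ?_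
  filter_upwards [ae_restrict_mem measurableSet_Ioi] with t ht
  have ht0 : 0 ≤ t := le_of_lt ht
  rw [jointTail, Real.norm_of_nonneg (Finset.prod_nonneg fun i _ => gammaTail_nonneg _ ht0),
    ← Finset.mul_prod_erase _ _ (Finset.mem_univ ⟨0, hn⟩)]
  exact mul_le_of_le_one_right (gammaTail_nonneg _ ht0)
    (Finset.prod_le_one (fun i _ => gammaTail_nonneg _ ht0) fun i _ => gammaTail_le_one _ ht0)

theorem jointTail_remove (d : Deck n) (i : Fin n) (t : ℝ) :
    jointTail (d.remove i) t =
      gammaTail (d i - 1) t * ∏ j ∈ Finset.univ.erase i, gammaTail (d j) t := by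
  rw [jointTail, ← Finset.mul_prod_erase _ _ (Finset.mem_univ i), Deck.remove_self]
  refine congrArg _ (Finset.prod_congr rfl fun j hj => ?_)
  rw [Deck.remove_of_ne d (Finset.ne_of_mem_erase hj)]

theorem hasDerivAt_jointTail (d : Deck n) (t : ℝ) :
    HasDerivAt (jointTail d) (∑ i, (jointTail (d.remove i) t - jointTail d t)) t := by
  have h := HasDerivAt.fun_finsetProd (u := Finset.univ) (x := t)
    fun i _ => hasDerivAt_gammaTail (d i) t
  refine h.congr_deriv (Finset.sum_congr rfl fun i hi => ?_)
  rw [jointTail_remove, jointTail, ← Finset.mul_prod_erase _ _ hi, smul_eq_mul]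
  ring

theorem jointTail_eq_zero {d : Deck n} (h : d.supp ≠ Finset.univ) (t : ℝ) :
    jointTail d t = 0 := by
  obtain ⟨i, hi⟩ : ∃ i, i ∉ d.supp := by
    by_contra! hc
    exact h (Finset.eq_univ_of_forall hc)
  refine Finset.prod_eq_zero (Finset.mem_univ i) ?_
  rw [Deck.mem_supp_iff, not_lt, nonpos_iff_eq_zero] at hi
  rw [hi, gammaTail_zero]

/-- Integrate the derivative of `jointTail d` over the half-line: it falls from `1` at `0` to `0` at
infinity. The result is the recursion of `greedyMin`. -/
theorem card_mul_meanMin (hn : 0 < n) {d : Deck n} (h : d.supp = Finset.univ) :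
    n * meanMin d = 1 + ∑ i, meanMin (d.remove i) := by
  have hd : ∀ i, 0 < d i := fun i => Deck.mem_supp_iff.mp (h ▸ Finset.mem_univ i)
  have hint : ∀ i ∈ (Finset.univ : Finset (Fin n)),
      IntegrableOn (fun t => jointTail (d.remove i) t - jointTail d t) (Set.Ioi 0) :=
    fun i _ => (integrableOn_jointTail hn _).sub (integrableOn_jointTail hn _)
  have hlim : Tendsto (jointTail d) atTop (nhds 0) := by
    have := tendsto_finsetProd Finset.univ fun i _ => tendsto_gammaTail_atTop (d i)
    rwa [Finset.prod_const, zero_pow] at this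
    rw [Finset.card_univ, Fintype.card_fin]
    exact hn.ne'
  have key := integral_Ioi_of_hasDerivAt_of_tendsto' (a := 0)
    (fun t _ => hasDerivAt_jointTail d t) (integrable_finsetSum _ hint) hlim
  rw [integral_finsetSum _ hint, Finset.sum_congr rfl fun i _ =>
    integral_sub (integrableOn_jointTail hn _) (integrableOn_jointTail hn _),
    Finset.sum_sub_distrib, Finset.sum_const, Finset.card_univ, Fintype.card_fin, nsmul_eq_mul,
    jointTail, Finset.prod_congr rfl fun i _ => gammaTail_apply_zero (hd i),
    Finset.prod_const_one] at key
  unfold meanMin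
  linarith

theorem greedyMin_eq_meanMin (hn : 0 < n) (d : Deck n) : greedyMin d = meanMin d := by
  have hzero : ∀ d : Deck n, d.supp ≠ Finset.univ → greedyMin d = meanMin d := fun d h => by
    rw [greedyMin_eq_zero d h, meanMin]
    simp [jointTail_eq_zero h]
  induction d using Deck.induction with
  | zero =>
    refine hzero _ fun h => ?_
    have := h ▸ Finset.mem_univ (⟨0, hn⟩ : Fin n)
    simp [Deck.supp] at this
  | step d hd ih =>
    by_cases h : d.supp = Finset.univ
    swap
    · exact hzero d h
    have e := card_mul_greedyMin hd
    have e' := card_mul_meanMin hn h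
    rw [if_pos h, Finset.sum_congr rfl ih, h, Finset.card_univ, Fintype.card_fin, ← e'] at e
    exact mul_left_cancel₀ (by exact_mod_cast hn.ne') e

theorem greedyMin_const_eq (hn : 0 < n) (m : ℕ) :
    greedyMin (fun _ : Fin n => m) = ∫ t in Set.Ioi 0, gammaTail m t ^ n := by
  rw [greedyMin_eq_meanMin hn]
  simp [meanMin, jointTail]

/-! ### Scaling limit of the minimum -/

/-- Multiplied out, the polynomial is bounded by the first `2m` terms of the exponential series,
since `(m + j)! ≤ (2m)!` for `j < m`. -/
theorem gammaTail_mul_le_one (m : ℕ) {t : ℝ} (ht : 0 ≤ t) :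
    gammaTail m t * (1 + t ^ m / (2 * m).factorial) ≤ 1 := by
  have h : (∑ j ∈ Finset.range m, t ^ j / j.factorial) * (1 + t ^ m / (2 * m).factorial) ≤
      Real.exp t := by
    refine le_trans ?_ (Real.sum_le_exp_of_nonneg ht (m + m))
    rw [Finset.sum_range_add, mul_add, mul_one, Finset.sum_mul]
    gcongr with j hj
    rw [div_mul_div_comm, ← pow_add, add_comm j m]
    gcongr
    have h1 : (m + j).factorial ≤ (2 * m).factorial :=
      Nat.factorial_le (by have := Finset.mem_range.mp hj; omega)
    have h2 : 1 ≤ j.factorial := Nat.factorial_pos j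
    exact_mod_cast h1.trans (Nat.le_mul_of_pos_left _ h2)
  calc _ = Real.exp (-t) * ((∑ j ∈ Finset.range m, t ^ j / j.factorial) *
        (1 + t ^ m / (2 * m).factorial)) := by rw [gammaTail, mul_assoc]
    _ ≤ Real.exp (-t) * Real.exp t := by gcongr
    _ = 1 := by rw [← Real.exp_add, neg_add_cancel, Real.exp_zero]

/-- Bernoulli with exponent `n / 2`. The square is what yields integrable decay even when `m = 1`.
-/
theorem one_add_half_sq_le {u : ℝ} (hu : 0 ≤ u) (hn : 2 ≤ n) :
    (1 + u / 2) ^ 2 ≤ (1 + u / n) ^ n := by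
  have hn' : (2 : ℝ) ≤ n := by exact_mod_cast hn
  have hn0 : (0 : ℝ) < n := by linarith
  have hun : 0 ≤ u / n := by positivity
  have h := one_add_mul_self_le_rpow_one_add (s := u / n) (by linarith) (p := n / 2) (by linarith)
  calc (1 + u / 2) ^ 2 = (1 + (n / 2 : ℝ) * (u / n)) ^ 2 := by field_simp
    _ ≤ ((1 + u / n) ^ (n / 2 : ℝ)) ^ 2 := by gcongr
    _ = (1 + u / n) ^ n := by
      rw [← Real.rpow_natCast, ← Real.rpow_mul (by positivity), ← Real.rpow_natCast]
      congr 1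
      push_cast
      ring

/-- The dominating function, uniform in `n`, for the rescaled integrals. The constant is the square
of the `4 * N` in `h4`. -/
theorem gammaTail_pow_le (m : ℕ) (hm : 1 ≤ m) (hn : 2 ≤ n) {b s : ℝ} (hb : 0 ≤ b)
    (hbm : b ^ m = (n : ℝ)⁻¹) (hs : 0 ≤ s) :
    gammaTail m (b * s) ^ n ≤ 16 * ((2 * m).factorial : ℝ) ^ 2 * (1 + s ^ 2)⁻¹ := by
  set N : ℝ := ((2 * m).factorial : ℝ) with hN
  have hN1 : 1 ≤ N := Nat.one_le_cast.mpr (Nat.factorial_pos _)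
  have hn0 : (0 : ℝ) < n := by exact_mod_cast (by omega : 0 < n)
  have ht : 0 ≤ b * s := by positivity
  have h1 := gammaTail_mul_le_one m ht
  have h2 : (b * s) ^ m / N = s ^ m / N / n := by
    rw [mul_pow, hbm]
    field_simp
  rw [← hN, h2] at h1
  have h3 := one_add_half_sq_le (n := n) (u := s ^ m / N) (by positivity) hn
  have h4 : 1 + s ≤ 4 * N * (1 + s ^ m / N / 2) := by
    have e : 4 * N * (1 + s ^ m / N / 2) = 4 * N + 2 * s ^ m := by field_simp; ring
    rw [e]
    rcases le_total s 1 with h | h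
    · have : 0 ≤ s ^ m := by positivity
      linarith
    · have : s ≤ s ^ m := le_self_pow₀ h (by omega)
      linarith
  have h5 : 1 + s ^ 2 ≤ 16 * N ^ 2 * (1 + s ^ m / N / 2) ^ 2 := by
    calc 1 + s ^ 2 ≤ (1 + s) ^ 2 := by nlinarith
      _ ≤ (4 * N * (1 + s ^ m / N / 2)) ^ 2 := by gcongr
      _ = _ := by ring
  have h6 : gammaTail m (b * s) ^ n * (1 + s ^ m / N / n) ^ n ≤ 1 := by
    rw [← mul_pow]
    exact pow_le_one₀ (mul_nonneg (gammaTail_nonneg m ht) (by positivity)) h1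
  have h7 : 0 ≤ gammaTail m (b * s) ^ n := pow_nonneg (gammaTail_nonneg m ht) n
  rw [← div_eq_mul_inv, le_div_iff₀ (by positivity)]
  calc gammaTail m (b * s) ^ n * (1 + s ^ 2)
      ≤ gammaTail m (b * s) ^ n * (16 * N ^ 2 * (1 + s ^ m / N / n) ^ n) := by
        gcongr
        exact h5.trans (by gcongr)
    _ = 16 * N ^ 2 * (gammaTail m (b * s) ^ n * (1 + s ^ m / N / n) ^ n) := by ring
    _ ≤ 16 * N ^ 2 := mul_le_of_le_one_right (by positivity) h6

/-- `1 - gammaTail m t` is `exp (-t)` times the exponential series from degree `m` on, whose leading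
term is `t^m / m!`. -/
theorem tendsto_one_sub_gammaTail_div_pow (m : ℕ) :
    Tendsto (fun t : ℝ => (1 - gammaTail m t) / t ^ m) (nhdsWithin 0 (Set.Ioi 0))
      (nhds ((m.factorial : ℝ)⁻¹)) := by
  set K : ℝ := (m + 1).succ / ((m + 1).factorial * (m + 1 : ℕ)) with hK
  have hid : Tendsto (fun t : ℝ => t) (nhdsWithin 0 (Set.Ioi 0)) (nhds 0) :=
    tendsto_id.mono_left nhdsWithin_le_nhds
  have hR : Tendsto (fun t : ℝ =>
      (Real.exp t - ∑ j ∈ Finset.range (m + 1), t ^ j / j.factorial) / t ^ m)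
      (nhdsWithin 0 (Set.Ioi 0)) (nhds 0) := by
    have hb : Tendsto (fun t : ℝ => t * K) (nhdsWithin 0 (Set.Ioi 0)) (nhds 0) := by
      simpa using hid.mul_const K
    refine squeeze_zero_norm' ?_ hb
    filter_upwards [Ioo_mem_nhdsGT (zero_lt_one' ℝ)] with t ht
    have ht0 : 0 < t := ht.1
    have h := Real.exp_bound (x := t) (by rw [abs_of_pos ht0]; exact ht.2.le) (n := m + 1)
      m.succ_pos
    rw [abs_of_pos ht0] at h
    rw [norm_div, Real.norm_eq_abs, Real.norm_of_nonneg (by positivity),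
      div_le_iff₀ (by positivity)]
    refine h.trans_eq ?_
    rw [← hK]
    ring
  have hE : Tendsto (fun t : ℝ => Real.exp (-t)) (nhdsWithin 0 (Set.Ioi 0)) (nhds 1) := by
    have h : Tendsto (fun t : ℝ => Real.exp (-t)) (nhds 0) (nhds (Real.exp (-0))) :=
      (Real.continuous_exp.comp continuous_neg).tendsto 0
    rw [neg_zero, Real.exp_zero] at h
    exact h.mono_left nhdsWithin_le_nhds
  have h := hE.mul (hR.add_const ((m.factorial : ℝ)⁻¹))
  rw [zero_add, one_mul] at h
  refine h.congr' ?_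
  filter_upwards [self_mem_nhdsWithin] with t ht
  have ht0 : (0 : ℝ) < t := ht
  have e : Real.exp (-t) * Real.exp t = 1 := by rw [← Real.exp_add, neg_add_cancel, Real.exp_zero]
  rw [Finset.sum_range_succ, gammaTail, eq_div_iff (by positivity), ← e]
  field_simp
  ring

theorem tendsto_mul_integral_gammaTail_pow (m : ℕ) (hm : 1 ≤ m) :
    Tendsto (fun n : ℕ => (n : ℝ) ^ (1 / (m : ℝ)) * ∫ t in Set.Ioi 0, gammaTail m t ^ n) atTop
      (nhds (Real.Gamma (1 + 1 / (m : ℝ)) * (m.factorial : ℝ) ^ (1 / (m : ℝ)))) := by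
  have hm0 : (0 : ℝ) < m := by exact_mod_cast hm
  set b : ℕ → ℝ := fun n => (n : ℝ) ^ (-(1 / (m : ℝ))) with hb
  have hb0 : ∀ n : ℕ, 1 ≤ n → 0 < b n := fun n hn =>
    Real.rpow_pos_of_pos (by exact_mod_cast hn) _
  have hbm : ∀ n : ℕ, b n ^ m = (n : ℝ)⁻¹ := fun n => by
    rw [hb, ← Real.rpow_natCast, ← Real.rpow_mul (Nat.cast_nonneg n), ← Real.rpow_neg_one]
    congr 1
    field_simp
  have hblim : Tendsto b atTop (nhds 0) :=
    (tendsto_rpow_neg_atTop (by positivity)).comp tendsto_natCast_atTop_atTop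
  have hlim : Tendsto (fun n : ℕ => ∫ s in Set.Ioi 0, gammaTail m (b n * s) ^ n) atTop
      (nhds (∫ s in Set.Ioi 0, Real.exp (-(m.factorial : ℝ)⁻¹ * s ^ (m : ℝ)))) := by
    refine tendsto_integral_filter_of_dominated_convergence
      (fun s => 16 * ((2 * m).factorial : ℝ) ^ 2 * (1 + s ^ 2)⁻¹) ?_ ?_
      (integrable_inv_one_add_sq.const_mul _).integrableOn ?_
    · refine Eventually.of_forall fun n => Continuous.aestronglyMeasurable ?_
      exact ((continuous_gammaTail m).comp (continuous_const.mul continuous_id)).pow n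
    · filter_upwards [eventually_ge_atTop 2] with n hn
      filter_upwards [ae_restrict_mem measurableSet_Ioi] with s hs
      have hs0 : 0 ≤ s := le_of_lt hs
      have hbn := (hb0 n (by omega)).le
      rw [Real.norm_of_nonneg (pow_nonneg (gammaTail_nonneg m (mul_nonneg hbn hs0)) n)]
      exact gammaTail_pow_le m hm hn hbn (hbm n) hs0
    · filter_upwards [ae_restrict_mem measurableSet_Ioi] with s hs
      have hs0 : 0 < s := hs
      have h1 : Tendsto (fun n => b n * s) atTop (nhdsWithin 0 (Set.Ioi 0)) := by
        refine tendsto_nhdsWithin_iff.mpr ⟨by simpa using hblim.mul_const s, ?_⟩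
        filter_upwards [eventually_ge_atTop 1] with n hn
        exact mul_pos (hb0 n hn) hs0
      have h2 := ((tendsto_one_sub_gammaTail_div_pow m).comp h1).const_mul (-(s ^ m))
      -- Since `b n ^ m = 1 / n`, the tail is `1 - s^m / (m! n)` to first order, and its `n`-th
      -- power tends to `exp (-s^m / m!)`.
      have h3 : Tendsto (fun n : ℕ => (n : ℝ) * (gammaTail m (b n * s) - 1)) atTop
          (nhds (-(s ^ m) * (m.factorial : ℝ)⁻¹)) := by
        refine h2.congr' ?_
        filter_upwards [eventually_ge_atTop 1] with n hn
        have hn0 : (0 : ℝ) < n := by exact_mod_cast hn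
        simp only [Function.comp_apply]
        rw [mul_pow, hbm]
        field_simp
        ring
      have h4 := Real.tendsto_one_add_pow_exp_of_tendsto h3
      simp only [add_sub_cancel] at h4
      rw [Real.rpow_natCast, neg_mul, mul_comm, ← neg_mul]
      exact h4
  rw [integral_exp_neg_mul_rpow hm0 (by positivity)] at hlim
  have e : ((m.factorial : ℝ)⁻¹) ^ (-1 / (m : ℝ)) * Real.Gamma (1 / m + 1) =
      Real.Gamma (1 + 1 / (m : ℝ)) * (m.factorial : ℝ) ^ (1 / (m : ℝ)) := by
    rw [Real.inv_rpow (by positivity), neg_div, Real.rpow_neg (by positivity), inv_inv, mul_comm,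
      add_comm]
  rw [e] at hlim
  refine hlim.congr' ?_
  filter_upwards [eventually_ge_atTop 1] with n hn
  rw [integral_comp_mul_left_Ioi (fun t => gammaTail m t ^ n) 0 (hb0 n hn), mul_zero, smul_eq_mul]
  simp only [hb]
  rw [Real.rpow_neg (Nat.cast_nonneg n), inv_inv]

theorem greedyMin_const_isEquivalent (m : ℕ) (hm : 1 ≤ m) :
    (fun n : ℕ => greedyMin fun _ : Fin n => m) ~[atTop] fun n : ℕ =>
      Real.Gamma (1 + 1 / (m : ℝ)) * (m.factorial : ℝ) ^ (1 / (m : ℝ)) *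
        (n : ℝ) ^ (-(1 / (m : ℝ))) := by
  have hC : 0 < Real.Gamma (1 + 1 / (m : ℝ)) * (m.factorial : ℝ) ^ (1 / (m : ℝ)) :=
    mul_pos (Real.Gamma_pos_of_pos (by positivity)) (by positivity)
  set C := Real.Gamma (1 + 1 / (m : ℝ)) * (m.factorial : ℝ) ^ (1 / (m : ℝ))
  refine isEquivalent_of_tendsto_one ?_
  have h := (tendsto_mul_integral_gammaTail_pow m hm).div_const C
  rw [div_self hC.ne'] at h
  refine h.congr' ?_
  filter_upwards [eventually_ge_atTop 1] with n hn
  have hn0 : (0 : ℝ) < n := by exact_mod_cast hn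
  rw [Pi.div_apply, greedyMin_const_eq hn, Real.rpow_neg hn0.le]
  have : (0 : ℝ) < (n : ℝ) ^ (1 / (m : ℝ)) := by positivity
  field_simp

end GuesserShuffler

end

/-- For fixed `m ≥ 1`: all the minima and maxima are attained, the min-max and max-min values are
the best and worst Guesser scores against the greedy Shuffler, and they are asymptotic, as
`n → ∞`, to `log n` and to `Γ(1 + 1/m) (m!)^(1/m) n^(-1/m)`. -/
theorem theorem1p3 (m : ℕ) (hm : 1 ≤ m) :
    ((∀ (n : ℕ) (S : GuesserShuffler.ShufflerStrategy),
        IsGreatest (Set.range fun G => GuesserShuffler.expScore m n G S)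
          (GuesserShuffler.maxScore m n S)) ∧
      (∀ n : ℕ,
        IsLeast (Set.range fun S => GuesserShuffler.maxScore m n S)
          (GuesserShuffler.minMaxScore m n)) ∧
      (∀ n : ℕ, GuesserShuffler.minMaxScore m n =
        GuesserShuffler.maxScore m n GuesserShuffler.greedy) ∧
      (fun n : ℕ => GuesserShuffler.minMaxScore m n) ~[atTop] (fun n : ℕ => Real.log n)) ∧
    ((∀ (n : ℕ) (S : GuesserShuffler.ShufflerStrategy),
        IsLeast (Set.range fun G => GuesserShuffler.expScore m n G S)
          (GuesserShuffler.minScore m n S)) ∧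
      (∀ n : ℕ,
        IsGreatest (Set.range fun S => GuesserShuffler.minScore m n S)
          (GuesserShuffler.maxMinScore m n)) ∧
      (∀ n : ℕ, GuesserShuffler.maxMinScore m n =
        GuesserShuffler.minScore m n GuesserShuffler.greedy) ∧
      (fun n : ℕ => GuesserShuffler.maxMinScore m n) ~[atTop]
        (fun n : ℕ => Real.Gamma (1 + 1 / (m : ℝ)) * (m.factorial : ℝ) ^ (1 / (m : ℝ)) *
          (n : ℝ) ^ (-(1 / (m : ℝ))))) := by
  refine ⟨⟨fun n S => ?_, fun n => ?_, fun n => ?_, ?_⟩,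
    fun n S => ?_, fun n => ?_, fun n => ?_, ?_⟩
  · exact GuesserShuffler.maxScore_eq m n S ▸ GuesserShuffler.isGreatest_expScore m n S
  · exact GuesserShuffler.minMaxScore_eq m n ▸ GuesserShuffler.isLeast_maxScore m n
  · rw [GuesserShuffler.minMaxScore_eq, GuesserShuffler.maxScore_eq]; rfl
  · simpa only [GuesserShuffler.minMaxScore_eq] using
      GuesserShuffler.greedyMax_const_isEquivalent m hm
  · exact GuesserShuffler.minScore_eq m n S ▸ GuesserShuffler.isLeast_expScore m n S
  · exact GuesserShuffler.maxMinScore_eq m n ▸ GuesserShuffler.isGreatest_minScore m n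
  · rw [GuesserShuffler.maxMinScore_eq, GuesserShuffler.minScore_eq]; rfl
  · simpa only [GuesserShuffler.maxMinScore_eq] using
      GuesserShuffler.greedyMin_const_isEquivalent m hm
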